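/- Let $\mathcal X\subset\mathbb R^d$ be a bounded open set with Lipschitz boundary, let $p\in C^1(\overline{\mathcal X})$ with $p>0$ on $\mathcal X$, let $y\in H^1(\mathcal X)$, and let $\rho,\gamma\in[0,1]$, $\bar\rho=1-\rho$, $\bar\gamma=1-\gamma$. For $\hat\mu,\hat\Lambda\in H^1(\mathcal X)$ with $\hat\Lambda\ge c>0$ a.e. put $$\mathbf S_{\rho,\gamma}[\hat\mu,\hat\Lambda]=\int_{\mathcal X}p(x)\Big[-\rho\log\mathcal N\big(y(x)\,\big|\,\hat\mu(x),\hat\Lambda(x)^{-1}\big)+\bar\rho\big(\gamma\|\nabla\hat\mu(x)\|_2^2+\bar\gamma\|\nabla\hat\Lambda(x)\|_2^2\big)\Big]\,dx ,$$ where $\mathcal N(\cdot\,|\,m,v)$ is the Gaussian density with mean $m$ and variance $v$. Call $(\hat\mu,\hat\Lambda)$ a stationary point of $\mathbf S_{\rho,\gamma}$ if the integrand is integrable at $(\hat\mu,\hat\Lambda)$ and $$\frac{d}{d\varepsilon}\Big|_{\varepsilon=0}\mathbf S_{\rho,\gamma}[\hat\mu+\varepsilon\varphi,\hat\Lambda+\varepsilon\psi]=0\qquad\text{for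 all }\varphi,\psi\in H^1(\mathcal X)\cap L^\infty(\mathcal X).$$ For $f\in H^1(\mathcal X)$ let $\mathcal L_pf=-\nabla\!\cdot(p\nabla f)$, the distribution on $\mathcal X$ given by $\langle\mathcal L_pf,\varphi\rangle=\int_{\mathcal X}p\,\nabla f\cdot\nabla\varphi\,dx$ for $\varphi\in C_c^\infty(\mathcal X)$. When $\mathcal L_pf\in L^1(\mathcal X)$, the condition $p\nabla f\cdot\boldsymbol n=0$ on $\partial\mathcal X$ means that the normal trace defined by Green's formula vanishes: $$\int_{\mathcal X}p\,\nabla f\cdot\nabla g\,dx-\int_{\mathcal X}(\mathcal L_pf)\,g\,dx=0\qquad\text{for all }g\in H^1(\mathcal X)\cap L^\infty(\mathcal X).$$ Then every stationary point $(\hat\mu,\hat\Lambda)$ of $\mathbf S_{\rho,\gamma}$ satisfies, in the sense of distributions on $\mathcal X$, $$\rho\,p\,\hat\Lambda(\hat\mu-y)=-2\bar\rho\gamma\,\mathcal L_p\hat\mu,\qquad \frac{\rho}{2}\,p\Big[(\hat\mu-y)^2-\frac1{\hat\Lambda}\Big]=-2\bar\rho\bar\gamma\,\mathcal L_p\hat\Lambda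 .$$ Moreover, if $\bar\rho\gamma>0$, then $\mathcal L_p\hat\mu\in L^1(\mathcal X)$, the first equation holds a.e. in $\mathcal X$, and $p\nabla\hat\mu\cdot\boldsymbol n=0$ on $\partial\mathcal X$; if $\bar\rho\bar\gamma>0$, then $\mathcal L_p\hat\Lambda\in L^1(\mathcal X)$, the second equation holds a.e. in $\mathcal X$, and $p\nabla\hat\Lambda\cdot\boldsymbol n=0$ on $\partial\mathcal X$. In particular, for $\rho,\gamma\in(0,1)$ all of these conclusions hold. -/

import Mathlib

open MeasureTheory Set
open scoped ContDiff ENNReal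

noncomputable section

namespace FieldTheory

/-- A bounded (strongly) Lipschitz open set: near each boundary point `x₀` there is a unit vector
`v` (the vertical axis) such that, in a ball around `x₀`, `X` is exactly the set of points lying
strictly above the graph of a Lipschitz function `f` of the component `x - ⟪v, x⟫ v` of `x`
orthogonal to `v`. Connectedness is not required. -/
structure IsBoundedLipschitzDomain {d : ℕ} (X : Set (EuclideanSpace ℝ (Fin d))) : Prop where
  isOpen : IsOpen X
  isBounded : Bornology.IsBounded X
  locally_epigraph : ∀ x₀ ∈ frontier X,
    ∃ (v : EuclideanSpace ℝ (Fin d)) (r : ℝ) (K : NNReal) (f : EuclideanSpace ℝ (Fin d) → ℝ),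
      ‖v‖ = 1 ∧ 0 < r ∧ LipschitzWith K f ∧
        X ∩ Metric.ball x₀ r =
          {x | f (x - inner ℝ v x • v) < inner ℝ v x} ∩ Metric.ball x₀ r

/-- Test functions on `X`: the class `C_c^∞(X)`. -/
structure IsTestFunction {d : ℕ} (X : Set (EuclideanSpace ℝ (Fin d)))
    (φ : EuclideanSpace ℝ (Fin d) → ℝ) : Prop where
  contDiff : ContDiff ℝ ∞ φ
  hasCompactSupport : HasCompactSupport φ
  tsupport_subset : tsupport φ ⊆ X

/-- `G` is an `L²(X)` weak gradient of `f` on `X`: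
`∫_X f ∂_v φ = - ∫_X φ ⟪G, v⟫` for all test functions `φ` and all directions `v`. -/
structure IsWeakGradient {d : ℕ} (X : Set (EuclideanSpace ℝ (Fin d)))
    (f : EuclideanSpace ℝ (Fin d) → ℝ)
    (G : EuclideanSpace ℝ (Fin d) → EuclideanSpace ℝ (Fin d)) : Prop where
  memLp : MemLp G 2 (volume.restrict X)
  integral_eq : ∀ φ : EuclideanSpace ℝ (Fin d) → ℝ, IsTestFunction X φ →
    ∀ v : EuclideanSpace ℝ (Fin d),
      ∫ x in X, f x * fderiv ℝ φ x v = - ∫ x in X, φ x * inner ℝ (G x) v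

/-- The Sobolev space `H¹(X) = W^{1,2}(X)`. -/
structure MemH1 {d : ℕ} (X : Set (EuclideanSpace ℝ (Fin d)))
    (f : EuclideanSpace ℝ (Fin d) → ℝ) : Prop where
  memLp : MemLp f 2 (volume.restrict X)
  exists_weakGradient : ∃ G, IsWeakGradient X f G

open Classical in
/-- The weak gradient of `f` on `X` (determined almost everywhere on the open set `X` when
`f ∈ H¹(X)`); the junk value is `0` if there is none. -/
def weakGrad {d : ℕ} (X : Set (EuclideanSpace ℝ (Fin d)))
    (f : EuclideanSpace ℝ (Fin d) → ℝ) :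
    EuclideanSpace ℝ (Fin d) → EuclideanSpace ℝ (Fin d) :=
  if h : ∃ G, IsWeakGradient X f G then h.choose else 0

/-- The integrand of the penalized Gaussian negative log-likelihood functional:
`p(x) [-ρ log 𝒩(y(x) | μ(x), Λ(x)⁻¹) + (1-ρ)(γ ‖∇μ(x)‖² + (1-γ) ‖∇Λ(x)‖²)]`. -/
def actionDensity {d : ℕ} (X : Set (EuclideanSpace ℝ (Fin d)))
    (p y : EuclideanSpace ℝ (Fin d) → ℝ) (ρ γ : ℝ)
    (μ Λ : EuclideanSpace ℝ (Fin d) → ℝ) (x : EuclideanSpace ℝ (Fin d)) : ℝ :=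
  p x * (-ρ * Real.log (ProbabilityTheory.gaussianPDFReal (μ x) (Λ x)⁻¹.toNNReal (y x))
    + (1 - ρ) * (γ * ‖weakGrad X μ x‖ ^ 2 + (1 - γ) * ‖weakGrad X Λ x‖ ^ 2))

/-- The functional `S_{ρ,γ}[μ, Λ]`. -/
def action {d : ℕ} (X : Set (EuclideanSpace ℝ (Fin d)))
    (p y : EuclideanSpace ℝ (Fin d) → ℝ) (ρ γ : ℝ)
    (μ Λ : EuclideanSpace ℝ (Fin d) → ℝ) : ℝ :=
  ∫ x in X, actionDensity X p y ρ γ μ Λ x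

/-- `(μ, Λ)` is a stationary point of `S_{ρ,γ}`: the functional is finite there, and all its
directional derivatives along bounded `H¹` perturbations `(φ, ψ)` vanish.
(For `Λ ≥ c > 0` and bounded `ψ`, the field `Λ + ε ψ` remains bounded below by a positive
constant for all small `ε` of either sign, so these are two-sided admissible directions.) -/
structure IsStationary {d : ℕ} (X : Set (EuclideanSpace ℝ (Fin d)))
    (p y : EuclideanSpace ℝ (Fin d) → ℝ) (ρ γ : ℝ)
    (μ Λ : EuclideanSpace ℝ (Fin d) → ℝ) : Prop where
  finite : IntegrableOn (actionDensity X p y ρ γ μ Λ) X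
  variation_eq_zero : ∀ φ ψ : EuclideanSpace ℝ (Fin d) → ℝ,
    MemH1 X φ → MemLp φ ∞ (volume.restrict X) →
    MemH1 X ψ → MemLp ψ ∞ (volume.restrict X) →
      HasDerivAt (fun ε : ℝ => action X p y ρ γ
        (fun x => μ x + ε * φ x) (fun x => Λ x + ε * ψ x)) 0 0

/-- The weighted Laplacian `𝓛_p f = -∇·(p ∇f)` as a distribution on `X`:
`⟨𝓛_p f, φ⟩ = ∫_X p ∇f · ∇φ` for test functions `φ`. -/
def weightedLaplacian {d : ℕ} (X : Set (EuclideanSpace ℝ (Fin d)))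
    (p f φ : EuclideanSpace ℝ (Fin d) → ℝ) : ℝ :=
  ∫ x in X, p x * inner ℝ (weakGrad X f x) (gradient φ x)

/-- The distribution `𝓛_p f` on `X` is the integrable function `w`. -/
structure HasWeightedLaplacian {d : ℕ} (X : Set (EuclideanSpace ℝ (Fin d)))
    (p f w : EuclideanSpace ℝ (Fin d) → ℝ) : Prop where
  integrableOn : IntegrableOn w X
  integral_eq : ∀ φ : EuclideanSpace ℝ (Fin d) → ℝ, IsTestFunction X φ →
    ∫ x in X, w x * φ x = weightedLaplacian X p f φ

/-- For `w = 𝓛_p f`, the pairing of the normal trace `p ∇f · n` on `∂X` with (the trace of) `g`,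
as defined by Green's formula:
`∫_{∂X} g p ∇f · n dS = ∫_X p ∇f · ∇g - ∫_X (𝓛_p f) g`. -/
def normalFlux {d : ℕ} (X : Set (EuclideanSpace ℝ (Fin d)))
    (p f w g : EuclideanSpace ℝ (Fin d) → ℝ) : ℝ :=
  (∫ x in X, p x * inner ℝ (weakGrad X f x) (weakGrad X g x)) - ∫ x in X, w x * g x

/-- The homogeneous Neumann condition `p ∇f · n = 0` on `∂X`, where `w = 𝓛_p f` is integrable:
the normal trace annihilates every bounded `H¹` function. -/
def ZeroFlux {d : ℕ} (X : Set (EuclideanSpace ℝ (Fin d)))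
    (p f w : EuclideanSpace ℝ (Fin d) → ℝ) : Prop :=
  ∀ g : EuclideanSpace ℝ (Fin d) → ℝ, MemH1 X g → MemLp g ∞ (volume.restrict X) →
    normalFlux X p f w g = 0

end FieldTheory

end

namespace FieldTheory

variable {d : ℕ} {X : Set (EuclideanSpace ℝ (Fin d))}

local notation "𝔼" => EuclideanSpace ℝ (Fin d)

/-! ### Integrability criteria. -/

section Integrability

variable {α : Type*} [MeasurableSpace α] {m : Measure α}

/-! For positive precision the density is explicit: a residual term `p ρ Λ (μ - y)² / 2`, a term in
`log Λ`, and Dirichlet energies. Along a mean direction `φ` it is exactly quadratic in `ε`; along a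
precision direction `ψ` it is quadratic apart from `log (Λ + ε ψ)`, which is differentiated by
dominated convergence since `Λ ≥ c` and `ψ` is bounded. Vanishing of the linear coefficient gives a
weak Neumann problem tested against all bounded `H¹` functions (`mean_variation`,
`precision_variation`).

The delicate point is integrability of `p ρ Λ (μ - y)`: for `H¹` fields, `Λ (μ - y)²` need not be
integrable. Finiteness of the action supplies this, because all other terms are integrable
(`integrable_mul_sq_residual`).

Testing with `C_c^∞` functions yields the distributional equations. If the penalty coefficient is
nonzero, dividing by it exhibits the weighted Laplacian as an `L¹` function, and the remaining test
functions say that the normal flux vanishes (`exists_hasWeightedLaplacian_zeroFlux`). -/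

lemma integrable_inner_of_memLp_two {E : Type*} [NormedAddCommGroup E] [InnerProductSpace ℝ E]
    {F G : α → E} (hF : MemLp F 2 m) (hG : MemLp G 2 m) :
    Integrable (fun x => inner ℝ (F x) (G x)) m := by
  refine (hF.norm.integrable_mul hG.norm).mono (hF.1.inner hG.1) (ae_of_all _ fun x => ?_)
  simpa using abs_real_inner_le_norm (F x) (G x)

lemma exists_pos_ae_abs_le_of_memLp_top {f : α → ℝ} (hf : MemLp f ⊤ m) :
    ∃ C, 0 < C ∧ ∀ᵐ x ∂m, |f x| ≤ C :=
  ⟨|lpNorm f ⊤ m| + 1, by positivity, (ae_le_lpNorm_exponent_top hf).mono fun x hx => by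
    have := le_abs_self (lpNorm f ⊤ m)
    rw [Real.norm_eq_abs] at hx
    linarith⟩

/-- The logarithm is squeezed: `log c ≤ log L ≤ L - 1`. -/
lemma integrable_log_of_le [IsFiniteMeasure m] {L : α → ℝ} {c : ℝ} (hc : 0 < c)
    (hL : Integrable L m) (hLc : ∀ᵐ x ∂m, c ≤ L x) :
    Integrable (fun x => Real.log (L x)) m := by
  refine (hL.add (integrable_const |Real.log c|)).mono
    (Real.measurable_log.comp_aemeasurable hL.aemeasurable).aestronglyMeasurable ?_
  filter_upwards [hLc] with x hx
  have hx0 : 0 < L x := hc.trans_le hx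
  have h1 := Real.log_le_sub_one_of_pos hx0
  have h2 := Real.log_le_log hc hx
  have h3 := neg_abs_le (Real.log c)
  have h4 := abs_nonneg (Real.log c)
  simp only [Pi.add_apply, Real.norm_eq_abs]
  rw [abs_of_nonneg (by positivity : 0 ≤ L x + |Real.log c|), abs_le]
  constructor <;> linarith

end Integrability

/-! ### Derivatives of integral functionals. -/

section Calculus

/-- An expansion of an integral functional of a real parameter that is quadratic, up to a
perturbation whose integral has derivative `R'` at `0`, gives its derivative at `0`. -/
lemma hasDerivAt_integral_of_expansion {α : Type*} [MeasurableSpace α] {m : Measure α}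
    {S : ℝ → α → ℝ} {D B C : α → ℝ} {R : ℝ → α → ℝ} {R' : ℝ}
    (hD : Integrable D m) (hB : Integrable B m) (hC : Integrable C m)
    (hR : ∀ᶠ ε in nhds (0 : ℝ), Integrable (R ε) m)
    (hR' : HasDerivAt (fun ε => ∫ x, R ε x ∂m) R' 0)
    (hS : ∀ᶠ ε in nhds (0 : ℝ), S ε =ᵐ[m] fun x => D x + ε * B x + ε ^ 2 * C x + R ε x) :
    HasDerivAt (fun ε => ∫ x, S ε x ∂m) ((∫ x, B x ∂m) + R') 0 := by
  have key : (fun ε => ∫ x, S ε x ∂m) =ᶠ[nhds 0] fun ε =>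
      (∫ x, D x ∂m) + ε * (∫ x, B x ∂m) + ε ^ 2 * (∫ x, C x ∂m) + ∫ x, R ε x ∂m := by
    filter_upwards [hR, hS] with ε hRε hSε
    rw [integral_congr_ae hSε, integral_add _ hRε, integral_add _ (hC.const_mul _),
      integral_add hD (hB.const_mul _), integral_const_mul, integral_const_mul]
    · exact hD.add (hB.const_mul _)
    · exact (hD.add (hB.const_mul _)).add (hC.const_mul _)
  refine HasDerivAt.congr_of_eventuallyEq ?_ key
  have h1 := (hasDerivAt_id (0 : ℝ)).mul_const (∫ x, B x ∂m)
  have h2 := ((hasDerivAt_id (0 : ℝ)).pow 2).mul_const (∫ x, C x ∂m)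
  convert! ((h1.const_add (∫ x, D x ∂m)).add h2).add hR' using 1
  simp

/-- Differentiation of `∫ a log (L + ε ψ)` at `ε = 0` under the integral sign. -/
lemma hasDerivAt_integral_mul_log {α : Type*} [MeasurableSpace α] {m : Measure α}
    [IsFiniteMeasure m] {a L ψ : α → ℝ} {c A M : ℝ} (hc : 0 < c) (hM : 0 < M)
    (ha : AEStronglyMeasurable a m) (haA : ∀ᵐ x ∂m, ‖a x‖ ≤ A)
    (hL : Integrable L m) (hLc : ∀ᵐ x ∂m, c ≤ L x)
    (hψ : AEStronglyMeasurable ψ m) (hψM : ∀ᵐ x ∂m, |ψ x| ≤ M) :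
    (∀ᶠ ε in nhds (0 : ℝ),
      Integrable (fun x => a x * (Real.log (L x + ε * ψ x) - Real.log (L x))) m) ∧
    Integrable (fun x => a x * (ψ x / L x)) m ∧
    HasDerivAt (fun ε => ∫ x, a x * (Real.log (L x + ε * ψ x) - Real.log (L x)) ∂m)
      (∫ x, a x * (ψ x / L x) ∂m) 0 := by
  -- For `|ε| < δ` the perturbation is at most `c / 2`, so `L + ε ψ ≥ c / 2` and the `ε`-derivative
  -- is dominated by the constant `A * (M / (c / 2))`.
  set δ := c / (2 * M) with hδ
  have hδ0 : 0 < δ := by positivity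
  have hlow : ∀ᵐ x ∂m, ∀ ε ∈ Metric.ball (0 : ℝ) δ, c / 2 ≤ L x + ε * ψ x := by
    filter_upwards [hLc, hψM] with x hx hψx ε hε
    have hε' : |ε| ≤ δ := by simpa using (Metric.mem_ball.1 hε).le
    have : |ε * ψ x| ≤ c / 2 := by
      rw [abs_mul]
      calc |ε| * |ψ x| ≤ δ * M := by gcongr
        _ = c / 2 := by rw [hδ]; field_simp
    linarith [(abs_le.1 this).1]
  have hψint : Integrable ψ m := Integrable.of_bound hψ M hψM
  have hball : Metric.ball (0 : ℝ) δ ∈ nhds (0 : ℝ) := Metric.ball_mem_nhds _ hδ0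
  have hint : ∀ ε ∈ Metric.ball (0 : ℝ) δ,
      Integrable (fun x => a x * (Real.log (L x + ε * ψ x) - Real.log (L x))) m := by
    intro ε hε
    refine Integrable.bdd_mul (c := A) ?_ ha haA
    exact (integrable_log_of_le (half_pos hc) (hL.add (hψint.const_mul ε))
      (hlow.mono fun x hx => hx ε hε)).sub (integrable_log_of_le hc hL hLc)
  refine ⟨Filter.eventually_of_mem hball hint, ?_⟩
  have := hasDerivAt_integral_of_dominated_loc_of_deriv_le (μ := m) (𝕜 := ℝ)
    (F := fun ε x => a x * (Real.log (L x + ε * ψ x) - Real.log (L x)))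
    (F' := fun ε x => a x * (ψ x / (L x + ε * ψ x))) (x₀ := 0)
    (bound := fun _ => A * (M / (c / 2))) hball
    (Filter.eventually_of_mem hball fun ε hε => (hint ε hε).1)
    (hint 0 (Metric.mem_ball_self hδ0)) ?_ ?_ (integrable_const _) ?_
  · simpa using this
  · simp only [zero_mul, add_zero]
    exact ha.mul (hψ.aemeasurable.div hL.aemeasurable).aestronglyMeasurable
  · filter_upwards [hlow, haA, hψM] with x hx hax hψx ε hε
    rw [norm_mul, norm_div]
    have h1 := hx ε hε
    have h2 : c / 2 ≤ ‖L x + ε * ψ x‖ := h1.trans (le_abs_self _)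
    have h3 : 0 ≤ A := (norm_nonneg _).trans hax
    have h4 : ‖ψ x‖ ≤ M := hψx
    gcongr
  · filter_upwards [hlow] with x hx ε hε
    have h1 : L x + ε * ψ x ≠ 0 := ((half_pos hc).trans_le (hx ε hε)).ne'
    have h2 : HasDerivAt (fun ε : ℝ => L x + ε * ψ x) (ψ x) ε := by
      simpa using ((hasDerivAt_id ε).mul_const (ψ x)).const_add (L x)
    exact ((h2.log h1).sub_const _).const_mul _

lemma neg_mul_log_gaussianPDFReal (ρ m y : ℝ) {L : ℝ} (hL : 0 < L) :
    -ρ * Real.log (ProbabilityTheory.gaussianPDFReal m L⁻¹.toNNReal y) =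
      ρ * (Real.log (2 * Real.pi) / 2 - Real.log L / 2 + L * (m - y) ^ 2 / 2) := by
  have hpi := Real.pi_pos
  rw [ProbabilityTheory.gaussianPDFReal, Real.coe_toNNReal _ (inv_pos.2 hL).le,
    Real.log_mul (by positivity) (by positivity), Real.log_exp, Real.log_inv,
    Real.log_sqrt (by positivity), Real.log_mul (by positivity) (by positivity), Real.log_inv]
  field_simp
  ring

end Calculus

/-! ### Weak gradients and test functions. -/

section Sobolev

lemma IsTestFunction.memLp_restrict {φ : 𝔼 → ℝ} (hφ : IsTestFunction X φ) (q : ℝ≥0∞) :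
    MemLp φ q (volume.restrict X) :=
  (hφ.contDiff.continuous.memLp_of_hasCompactSupport hφ.hasCompactSupport).restrict X

lemma IsTestFunction.continuous_fderiv {φ : 𝔼 → ℝ} (hφ : IsTestFunction X φ) :
    Continuous (fderiv ℝ φ) :=
  hφ.contDiff.continuous_fderiv (by simp)

lemma IsTestFunction.continuous_gradient {φ : 𝔼 → ℝ} (hφ : IsTestFunction X φ) :
    Continuous (gradient φ) :=
  (InnerProductSpace.toDual ℝ 𝔼).symm.continuous.comp hφ.continuous_fderiv

lemma IsTestFunction.memLp_gradient {φ : 𝔼 → ℝ} (hφ : IsTestFunction X φ) (q : ℝ≥0∞) :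
    MemLp (gradient φ) q (volume.restrict X) :=
  (hφ.continuous_gradient.memLp_of_hasCompactSupport
    ((hφ.hasCompactSupport.fderiv ℝ).comp_left
      (g := (InnerProductSpace.toDual ℝ 𝔼).symm) (map_zero _))).restrict X

lemma IsTestFunction.memLp_fderiv {φ : 𝔼 → ℝ} (hφ : IsTestFunction X φ) (v : 𝔼) (q : ℝ≥0∞) :
    MemLp (fun x => fderiv ℝ φ x v) q (volume.restrict X) :=
  ((hφ.continuous_fderiv.clm_apply continuous_const).memLp_of_hasCompactSupport
    (hφ.hasCompactSupport.fderiv_apply ℝ v)).restrict X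

lemma IsWeakGradient.add_const_mul {f g : 𝔼 → ℝ} {F G : 𝔼 → 𝔼}
    (hfF : IsWeakGradient X f F) (hgG : IsWeakGradient X g G)
    (hf : MemLp f 2 (volume.restrict X)) (hg : MemLp g 2 (volume.restrict X)) (ε : ℝ) :
    IsWeakGradient X (fun x => f x + ε * g x) (fun x => F x + ε • G x) where
  memLp := hfF.memLp.add (hgG.memLp.const_smul ε)
  integral_eq φ hφ v := by
    have hdφ := hφ.memLp_fderiv v 2
    have hin : ∀ {H : 𝔼 → 𝔼}, MemLp H 2 (volume.restrict X) →
        Integrable (fun x => φ x * inner ℝ (H x) v) (volume.restrict X) := by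
      intro H hH
      have hφv : MemLp (fun x => φ x • v) 2 (volume.restrict X) :=
        (memLp_top_const v).smul (hφ.memLp_restrict 2)
      refine (integrable_inner_of_memLp_two hH hφv).congr (ae_of_all _ fun x => ?_)
      simp [inner_smul_right]
    have e1 : (fun x => (f x + ε * g x) * fderiv ℝ φ x v) =
        fun x => f x * fderiv ℝ φ x v + ε * (g x * fderiv ℝ φ x v) := by ext; ring
    have e2 : (fun x => φ x * inner ℝ (F x + ε • G x) v) =
        fun x => φ x * inner ℝ (F x) v + ε * (φ x * inner ℝ (G x) v) := by
      ext; rw [inner_add_left, real_inner_smul_left]; ring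
    have i1 : Integrable (fun x => f x * fderiv ℝ φ x v) (volume.restrict X) :=
      hf.integrable_mul hdφ
    have i2 : Integrable (fun x => g x * fderiv ℝ φ x v) (volume.restrict X) :=
      hg.integrable_mul hdφ
    rw [e1, e2, integral_add i1 (i2.const_mul ε),
      integral_add (hin hfF.memLp) ((hin hgG.memLp).const_mul ε), integral_const_mul,
      integral_const_mul, hfF.integral_eq φ hφ v, hgG.integral_eq φ hφ v]
    ring

/-- Weak gradients on an open set are unique almost everywhere. -/
lemma IsWeakGradient.ae_eq (hX : IsOpen X) {f : 𝔼 → ℝ} {F G : 𝔼 → 𝔼}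
    (hF : IsWeakGradient X f F) (hG : IsWeakGradient X f G) :
    F =ᵐ[volume.restrict X] G := by
  have hloc : LocallyIntegrableOn (fun x => F x - G x) X volume :=
    locallyIntegrableOn_of_locallyIntegrable_restrict
      ((hF.memLp.sub hG.memLp).locallyIntegrable (by norm_num))
  have := hX.ae_eq_zero_of_integral_contDiff_smul_eq_zero hloc ?_
  · rw [Filter.EventuallyEq, ae_restrict_iff' hX.measurableSet]
    filter_upwards [this] with x hx hxX using sub_eq_zero.1 (hx hxX)
  intro φ h1 h2 h3
  have hφ : IsTestFunction X φ := ⟨h1, h2, h3⟩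
  have hint : ∀ {H : 𝔼 → 𝔼}, MemLp H 2 (volume.restrict X) →
      Integrable (fun x => φ x • H x) (volume.restrict X) := fun hH =>
    memLp_one_iff_integrable.1 (hH.smul (hφ.memLp_restrict 2))
  have hset : ∫ x, φ x • (F x - G x) = ∫ x in X, φ x • (F x - G x) := by
    refine (setIntegral_eq_integral_of_forall_compl_eq_zero fun x hx => ?_).symm
    rw [image_eq_zero_of_notMem_tsupport fun h => hx (h3 h), zero_smul]
  rw [hset]
  have hI : Integrable (fun x => φ x • (F x - G x)) (volume.restrict X) :=
    hint (hF.memLp.sub hG.memLp)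
  -- The definition of weak gradient is scalar, so the vector integral is tested against each
  -- direction `v`.
  refine ext_inner_left ℝ fun v => ?_
  rw [inner_zero_right, ← integral_inner hI v]
  have e : ∀ {H : 𝔼 → 𝔼}, MemLp H 2 (volume.restrict X) →
      Integrable (fun x => φ x * inner ℝ (H x) v) (volume.restrict X) := fun hH =>
    ((hint hH).inner_const v).congr (ae_of_all _ fun x => by simp [real_inner_smul_left])
  have e2 : (fun x => inner ℝ v (φ x • (F x - G x))) =
      fun x => φ x * inner ℝ (F x) v - φ x * inner ℝ (G x) v := by
    ext x
    rw [real_inner_comm, real_inner_smul_left, inner_sub_left]; ring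
  rw [e2, integral_sub (e hF.memLp) (e hG.memLp)]
  linarith [hF.integral_eq φ hφ v, hG.integral_eq φ hφ v]

lemma MemH1.isWeakGradient {f : 𝔼 → ℝ} (hf : MemH1 X f) : IsWeakGradient X f (weakGrad X f) := by
  rw [weakGrad, dif_pos hf.exists_weakGradient]
  exact hf.exists_weakGradient.choose_spec

lemma weakGrad_ae_eq (hX : IsOpen X) {f : 𝔼 → ℝ} {G : 𝔼 → 𝔼} (hG : IsWeakGradient X f G) :
    weakGrad X f =ᵐ[volume.restrict X] G := by
  have h : ∃ G, IsWeakGradient X f G := ⟨G, hG⟩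
  rw [weakGrad, dif_pos h]
  exact h.choose_spec.ae_eq hX hG

/-- `weakGrad` is an arbitrary choice, so linearity holds only almost everywhere, through
uniqueness. -/
lemma weakGrad_add_const_mul_ae_eq (hX : IsOpen X) {f g : 𝔼 → ℝ} (hf : MemH1 X f)
    (hg : MemH1 X g) (ε : ℝ) :
    weakGrad X (fun x => f x + ε * g x) =ᵐ[volume.restrict X]
      fun x => weakGrad X f x + ε • weakGrad X g x :=
  weakGrad_ae_eq hX (hf.isWeakGradient.add_const_mul hg.isWeakGradient hf.memLp hg.memLp ε)

lemma MemH1.zero : MemH1 X (fun _ => 0) :=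
  ⟨MemLp.zero', fun _ => 0, MemLp.zero', fun φ _ v => by simp⟩

lemma IsTestFunction.isWeakGradient {φ : 𝔼 → ℝ} (hφ : IsTestFunction X φ) :
    IsWeakGradient X φ (gradient φ) where
  memLp := hφ.memLp_gradient 2
  integral_eq χ hχ v := by
    -- Both functions vanish off `X`, so the integration by parts takes place on the whole space and
    -- no boundary term appears.
    have huniv : ∀ {ξ : 𝔼 → ℝ}, IsTestFunction X ξ → IsTestFunction univ ξ :=
      fun h => ⟨h.contDiff, h.hasCompactSupport, subset_univ _⟩
    have L : ∀ {ξ : 𝔼 → ℝ}, IsTestFunction X ξ →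
        MemLp ξ 2 volume ∧ MemLp (fun x => fderiv ℝ ξ x v) 2 volume := fun h =>
      ⟨by simpa using (huniv h).memLp_restrict 2, by simpa using (huniv h).memLp_fderiv v 2⟩
    have hdiff : ∀ {ξ : 𝔼 → ℝ}, IsTestFunction X ξ → Differentiable ℝ ξ := fun h =>
      h.contDiff.differentiable (by simp)
    have key := integral_mul_fderiv_eq_neg_fderiv_mul_of_integrable (μ := volume) (v := v)
      ((L hφ).2.integrable_mul (L hχ).1) ((L hφ).1.integrable_mul (L hχ).2)
      ((L hφ).1.integrable_mul (L hχ).1) (fun x _ => hdiff hφ x) (fun x _ => hdiff hχ x)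
    have hz : ∀ x, x ∉ X → φ x = 0 := fun x hx =>
      image_eq_zero_of_notMem_tsupport fun h => hx (hφ.tsupport_subset h)
    have hz' : ∀ x, x ∉ X → χ x = 0 := fun x hx =>
      image_eq_zero_of_notMem_tsupport fun h => hx (hχ.tsupport_subset h)
    rw [setIntegral_eq_integral_of_forall_compl_eq_zero fun x hx => by rw [hz x hx, zero_mul],
      setIntegral_eq_integral_of_forall_compl_eq_zero fun x hx => by rw [hz' x hx, zero_mul], key]
    simp only [inner_gradient_left, mul_comm]

lemma IsTestFunction.memH1 {φ : 𝔼 → ℝ} (hφ : IsTestFunction X φ) : MemH1 X φ :=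
  ⟨hφ.memLp_restrict 2, _, hφ.isWeakGradient⟩

lemma integral_weakGrad_inner_eq_weightedLaplacian (hX : IsOpen X) (p f : 𝔼 → ℝ) {φ : 𝔼 → ℝ}
    (hφ : IsTestFunction X φ) :
    ∫ x in X, p x * inner ℝ (weakGrad X f x) (weakGrad X φ x) = weightedLaplacian X p f φ :=
  integral_congr_ae ((weakGrad_ae_eq hX hφ.isWeakGradient).mono fun x hx => by simp only [hx])

end Sobolev

/-! ### First variations and the Euler–Lagrange system. -/

section EulerLagrange

variable {p y μ Λ φ ψ : EuclideanSpace ℝ (Fin d) → ℝ} {ρ γ c P : ℝ}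

lemma actionDensity_of_pos {x : 𝔼} (hx : 0 < Λ x) :
    actionDensity X p y ρ γ μ Λ x =
      p x * (ρ * (Real.log (2 * Real.pi) / 2 - Real.log (Λ x) / 2 + Λ x * (μ x - y x) ^ 2 / 2)
        + (1 - ρ) * (γ * ‖weakGrad X μ x‖ ^ 2 + (1 - γ) * ‖weakGrad X Λ x‖ ^ 2)) := by
  rw [actionDensity, neg_mul_log_gaussianPDFReal ρ _ _ hx]

/-- Finiteness of the action controls the weighted square of the residual. -/
lemma integrable_mul_sq_residual [IsFiniteMeasure (volume.restrict X)]
    (hpm : AEStronglyMeasurable p (volume.restrict X))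
    (hpP : ∀ᵐ x ∂(volume.restrict X), ‖p x‖ ≤ P)
    (hμ : MemH1 X μ) (hΛ : MemH1 X Λ) (hc : 0 < c)
    (hΛc : ∀ᵐ x ∂(volume.restrict X), c ≤ Λ x)
    (hfin : IntegrableOn (actionDensity X p y ρ γ μ Λ) X) :
    Integrable (fun x => p x * (ρ * Λ x * (μ x - y x) ^ 2)) (volume.restrict X) := by
  have hlog := integrable_log_of_le hc (hΛ.memLp.integrable (by norm_num)) hΛc
  -- Everything in the density except the residual term; subtracting it and doubling isolates the
  -- weighted square.
  have h1 : Integrable (fun x => p x * (ρ * (Real.log (2 * Real.pi) / 2 - Real.log (Λ x) / 2)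
      + (1 - ρ) * (γ * ‖weakGrad X μ x‖ ^ 2 + (1 - γ) * ‖weakGrad X Λ x‖ ^ 2)))
      (volume.restrict X) := by
    refine Integrable.bdd_mul (c := P) ?_ hpm hpP
    have hg1 := hμ.isWeakGradient.memLp.integrable_norm_pow two_ne_zero
    have hg2 := hΛ.isWeakGradient.memLp.integrable_norm_pow two_ne_zero
    exact (((integrable_const _).sub (hlog.div_const 2)).const_mul ρ).add
      (((hg1.const_mul γ).add (hg2.const_mul (1 - γ))).const_mul (1 - ρ))
  refine ((Integrable.sub hfin h1).const_mul 2).congr ?_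
  filter_upwards [hΛc] with x hx
  simp only [Pi.sub_apply]
  rw [actionDensity_of_pos (hc.trans_le hx)]
  ring

lemma integrable_mul_residual [IsFiniteMeasure (volume.restrict X)]
    (hpm : AEStronglyMeasurable p (volume.restrict X))
    (hpP : ∀ᵐ x ∂(volume.restrict X), ‖p x‖ ≤ P)
    (hy : MemH1 X y) (hμ : MemH1 X μ) (hΛ : MemH1 X Λ) (hc : 0 < c)
    (hΛc : ∀ᵐ x ∂(volume.restrict X), c ≤ Λ x)
    (hfin : IntegrableOn (actionDensity X p y ρ γ μ Λ) X) :
    Integrable (fun x => ρ * p x * Λ x * (μ x - y x)) (volume.restrict X) := by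
  have h1 := integrable_mul_sq_residual hpm hpP hμ hΛ hc hΛc hfin
  have h2 : Integrable (fun x => p x * (ρ * Λ x)) (volume.restrict X) :=
    Integrable.bdd_mul (c := P) ((hΛ.memLp.integrable (by norm_num)).const_mul ρ) hpm hpP
  refine (h1.norm.add h2.norm).mono
    (((hpm.const_mul ρ).mul hΛ.memLp.1).mul (hμ.memLp.1.sub hy.memLp.1)) (ae_of_all _ fun x => ?_)
  have e1 : ρ * p x * Λ x * (μ x - y x) = (p x * (ρ * Λ x)) * (μ x - y x) := by ring
  have e2 : p x * (ρ * Λ x * (μ x - y x) ^ 2) = (p x * (ρ * Λ x)) * (μ x - y x) ^ 2 := by ring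
  -- Splits the linear residual into the weighted square and the integrable weight `p ρ Λ`.
  have h3 : |μ x - y x| ≤ (μ x - y x) ^ 2 + 1 := by
    nlinarith [sq_abs (μ x - y x), sq_nonneg (|μ x - y x| - 1), abs_nonneg (μ x - y x)]
  simp only [Pi.add_apply, e1, e2, norm_mul _ (μ x - y x), norm_mul _ ((μ x - y x) ^ 2)]
  rw [Real.norm_of_nonneg (sq_nonneg (μ x - y x)), Real.norm_eq_abs (μ x - y x)]
  refine le_trans ?_ (le_abs_self _)
  nlinarith [norm_nonneg (p x * (ρ * Λ x))]

lemma integrable_mul_sq_residual_sub_inv [IsFiniteMeasure (volume.restrict X)]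
    (hpm : AEStronglyMeasurable p (volume.restrict X))
    (hpP : ∀ᵐ x ∂(volume.restrict X), ‖p x‖ ≤ P)
    (hy : MemH1 X y) (hμ : MemH1 X μ) (hΛ : MemH1 X Λ) (hc : 0 < c)
    (hΛc : ∀ᵐ x ∂(volume.restrict X), c ≤ Λ x) (ρ : ℝ) :
    Integrable (fun x => ρ / 2 * p x * ((μ x - y x) ^ 2 - 1 / Λ x)) (volume.restrict X) := by
  have h1 : Integrable (fun x => (μ x - y x) ^ 2) (volume.restrict X) :=
    (hμ.memLp.sub hy.memLp).integrable_sq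
  have h2 : Integrable (fun x => 1 / Λ x) (volume.restrict X) := by
    refine Integrable.of_bound (C := 1 / c)
      (aemeasurable_const.div hΛ.memLp.1.aemeasurable).aestronglyMeasurable ?_
    filter_upwards [hΛc] with x hx
    rw [Real.norm_of_nonneg (one_div_nonneg.2 (hc.le.trans hx))]
    exact one_div_le_one_div_of_le hc hx
  refine ((Integrable.bdd_mul (c := P) (h1.sub h2) hpm hpP).const_mul (ρ / 2)).congr
    (ae_of_all _ fun x => ?_)
  simp only [Pi.sub_apply]
  ring

/-- The first variation with respect to the mean field. -/
lemma IsStationary.mean_variation [IsFiniteMeasure (volume.restrict X)] (hX : IsOpen X)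
    (hpm : AEStronglyMeasurable p (volume.restrict X))
    (hpP : ∀ᵐ x ∂(volume.restrict X), ‖p x‖ ≤ P)
    (hy : MemH1 X y) (hμ : MemH1 X μ) (hΛ : MemH1 X Λ) (hc : 0 < c)
    (hΛc : ∀ᵐ x ∂(volume.restrict X), c ≤ Λ x)
    (hstat : IsStationary X p y ρ γ μ Λ)
    (hφ : MemH1 X φ) (hφb : MemLp φ ⊤ (volume.restrict X)) :
    ∫ x in X, (ρ * p x * Λ x * (μ x - y x)) * φ x
      = -(2 * (1 - ρ) * γ * ∫ x in X, p x * inner ℝ (weakGrad X μ x) (weakGrad X φ x)) := by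
  obtain ⟨M, -, hM⟩ := exists_pos_ae_abs_le_of_memLp_top hφb
  have hres : Integrable (fun x => (ρ * p x * Λ x * (μ x - y x)) * φ x) (volume.restrict X) :=
    (integrable_mul_residual hpm hpP hy hμ hΛ hc hΛc hstat.finite).mul_bdd hφb.1 hM
  have hgrad : Integrable (fun x => p x * inner ℝ (weakGrad X μ x) (weakGrad X φ x))
      (volume.restrict X) := (integrable_inner_of_memLp_two hμ.isWeakGradient.memLp
        hφ.isWeakGradient.memLp).bdd_mul hpm hpP
  -- Since `Λ` is only `L²`, boundedness of `φ` is used twice to make `Λ φ²` integrable.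
  have hC : Integrable (fun x => p x * (ρ / 2 * (Λ x * φ x * φ x)
      + (1 - ρ) * γ * ‖weakGrad X φ x‖ ^ 2)) (volume.restrict X) := by
    refine Integrable.bdd_mul (c := P) ?_ hpm hpP
    exact ((((hΛ.memLp.integrable (by norm_num)).mul_bdd hφb.1 hM).mul_bdd hφb.1 hM).const_mul
      _).add ((hφ.isWeakGradient.memLp.integrable_norm_pow two_ne_zero).const_mul _)
  have hder := hasDerivAt_integral_of_expansion
    (S := fun ε => actionDensity X p y ρ γ (fun x => μ x + ε * φ x) Λ)
    (R := fun _ _ => 0) (R' := 0) hstat.finite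
    (hres.add (hgrad.const_mul (2 * (1 - ρ) * γ))) hC (by simp)
    (by simpa using hasDerivAt_const (0 : ℝ) (0 : ℝ)) (Filter.Eventually.of_forall fun ε => by
      filter_upwards [hΛc, weakGrad_add_const_mul_ae_eq hX hμ hφ ε] with x hx hgx
      have hx0 := hc.trans_le hx
      rw [actionDensity_of_pos hx0, actionDensity_of_pos hx0, hgx, norm_add_sq_real,
        real_inner_smul_right, norm_smul, mul_pow, Real.norm_eq_abs, sq_abs]
      simp only [Pi.add_apply]
      ring)
  have hstat' := hstat.variation_eq_zero φ (fun _ => 0) hφ hφb MemH1.zero MemLp.zero'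
  simp only [mul_zero, add_zero, action] at hstat'
  have h := hder.unique hstat'
  simp only [Pi.add_apply] at h
  rw [integral_add hres (hgrad.const_mul _), integral_const_mul] at h
  linarith

/-- The first variation with respect to the precision field. -/
lemma IsStationary.precision_variation [IsFiniteMeasure (volume.restrict X)] (hX : IsOpen X)
    (hpm : AEStronglyMeasurable p (volume.restrict X))
    (hpP : ∀ᵐ x ∂(volume.restrict X), ‖p x‖ ≤ P)
    (hy : MemH1 X y) (hμ : MemH1 X μ) (hΛ : MemH1 X Λ) (hc : 0 < c)
    (hΛc : ∀ᵐ x ∂(volume.restrict X), c ≤ Λ x)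
    (hstat : IsStationary X p y ρ γ μ Λ)
    (hψ : MemH1 X ψ) (hψb : MemLp ψ ⊤ (volume.restrict X)) :
    ∫ x in X, (ρ / 2 * p x * ((μ x - y x) ^ 2 - 1 / Λ x)) * ψ x
      = -(2 * (1 - ρ) * (1 - γ) *
          ∫ x in X, p x * inner ℝ (weakGrad X Λ x) (weakGrad X ψ x)) := by
  obtain ⟨M, hM0, hM⟩ := exists_pos_ae_abs_le_of_memLp_top hψb
  have hsq : Integrable (fun x => p x * ((μ x - y x) ^ 2 * ψ x)) (volume.restrict X) :=
    ((hμ.memLp.sub hy.memLp).integrable_sq.mul_bdd hψb.1 hM).bdd_mul hpm hpP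
  have hgrad : Integrable (fun x => p x * inner ℝ (weakGrad X Λ x) (weakGrad X ψ x))
      (volume.restrict X) := (integrable_inner_of_memLp_two hΛ.isWeakGradient.memLp
        hψ.isWeakGradient.memLp).bdd_mul hpm hpP
  have hC : Integrable (fun x => p x * ((1 - ρ) * (1 - γ) * ‖weakGrad X ψ x‖ ^ 2))
      (volume.restrict X) :=
    ((hψ.isWeakGradient.memLp.integrable_norm_pow two_ne_zero).const_mul _).bdd_mul hpm hpP
  -- The factor `-ρ / 2` is the coefficient of `log Λ` in the density; its derivative produces the
  -- `1 / Λ` term.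
  obtain ⟨hR, hRint, hR'⟩ := hasDerivAt_integral_mul_log (a := fun x => p x * (-ρ / 2))
    (A := P * ‖-ρ / 2‖) hc hM0 (hpm.mul_const _)
    (hpP.mono fun x hx => by rw [norm_mul]; gcongr)
    (hΛ.memLp.integrable (by norm_num)) hΛc hψb.1 hM
  have hder := hasDerivAt_integral_of_expansion
    (S := fun ε => actionDensity X p y ρ γ μ (fun x => Λ x + ε * ψ x)) hstat.finite
    ((hsq.const_mul (ρ / 2)).add (hgrad.const_mul (2 * (1 - ρ) * (1 - γ)))) hC hR hR' (by
      -- Within radius `c / M` the perturbed precision stays positive, so `toNNReal` does not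
      -- truncate and the explicit density applies.
      filter_upwards [Metric.ball_mem_nhds (0 : ℝ) (div_pos hc hM0)] with ε hε
      filter_upwards [hΛc, hM, weakGrad_add_const_mul_ae_eq hX hΛ hψ ε] with x hx hMx hgx
      have hx0 := hc.trans_le hx
      have hε' : |ε| < c / M := by simpa using hε
      have hlt : |ε * ψ x| < c := by
        rw [abs_mul]
        calc |ε| * |ψ x| ≤ |ε| * M := by gcongr
          _ < c := (lt_div_iff₀ hM0).1 hε'
      have hx1 : 0 < Λ x + ε * ψ x := by linarith [(abs_lt.1 hlt).1]
      rw [actionDensity_of_pos (Λ := fun x => Λ x + ε * ψ x) hx1, actionDensity_of_pos hx0, hgx,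
        norm_add_sq_real, real_inner_smul_right, norm_smul, mul_pow, Real.norm_eq_abs, sq_abs]
      simp only [Pi.add_apply]
      ring)
  have hstat' := hstat.variation_eq_zero (fun _ => 0) ψ MemH1.zero MemLp.zero' hψ hψb
  simp only [mul_zero, add_zero, action] at hstat'
  have h := hder.unique hstat'
  simp only [Pi.add_apply] at h
  rw [integral_add (hsq.const_mul _) (hgrad.const_mul _), integral_const_mul,
    integral_const_mul] at h
  have e : (fun x => (ρ / 2 * p x * ((μ x - y x) ^ 2 - 1 / Λ x)) * ψ x) =
      fun x => ρ / 2 * (p x * ((μ x - y x) ^ 2 * ψ x)) + p x * (-ρ / 2) * (ψ x / Λ x) := by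
    ext x; ring
  rw [e, integral_add (hsq.const_mul _) hRint, integral_const_mul]
  linarith

/-- A weak Neumann problem with integrable right-hand side, tested against all bounded `H¹`
functions, determines the weighted Laplacian and the normal flux. -/
lemma exists_hasWeightedLaplacian_zeroFlux (hX : IsOpen X) {f u : 𝔼 → ℝ} {κ : ℝ} (hκ : κ ≠ 0)
    (hu : IntegrableOn u X)
    (h : ∀ g : 𝔼 → ℝ, MemH1 X g → MemLp g ⊤ (volume.restrict X) →
      ∫ x in X, u x * g x
        = -(κ * ∫ x in X, p x * inner ℝ (weakGrad X f x) (weakGrad X g x))) :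
    ∃ w : 𝔼 → ℝ, HasWeightedLaplacian X p f w ∧
      (∀ᵐ x ∂(volume.restrict X), u x = -(κ * w x)) ∧ ZeroFlux X p f w := by
  have key : ∀ g : 𝔼 → ℝ, MemH1 X g → MemLp g ⊤ (volume.restrict X) →
      ∫ x in X, -κ⁻¹ * u x * g x
        = ∫ x in X, p x * inner ℝ (weakGrad X f x) (weakGrad X g x) := by
    intro g hg hgb
    simp only [mul_assoc]
    rw [integral_const_mul, h g hg hgb]
    field_simp
  -- The equation forces this choice of `w`; test functions identify it as the weighted Laplacian,
  -- general bounded `g` give zero flux.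
  refine ⟨fun x => -κ⁻¹ * u x, ⟨hu.const_mul _, fun φ hφ => ?_⟩, ae_of_all _ fun x => ?_,
    fun g hg hgb => ?_⟩
  · rw [key φ hφ.memH1 (hφ.memLp_restrict _), integral_weakGrad_inner_eq_weightedLaplacian hX p f hφ]
  · field_simp
  · rw [normalFlux, key g hg hgb, sub_self]

end EulerLagrange

end FieldTheory

theorem mainTheorem1 (d : ℕ) (X : Set (EuclideanSpace ℝ (Fin d)))
    (hX : FieldTheory.IsBoundedLipschitzDomain X)
    (p : EuclideanSpace ℝ (Fin d) → ℝ)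
    (hp : ContDiffOn ℝ 1 p (closure X)) (hp_pos : ∀ x ∈ X, 0 < p x)
    (y : EuclideanSpace ℝ (Fin d) → ℝ) (hy : FieldTheory.MemH1 X y)
    (ρ γ : ℝ) (hρ : ρ ∈ Set.Icc (0 : ℝ) 1) (hγ : γ ∈ Set.Icc (0 : ℝ) 1)
    (μ Λ : EuclideanSpace ℝ (Fin d) → ℝ)
    (hμ : FieldTheory.MemH1 X μ) (hΛ : FieldTheory.MemH1 X Λ)
    (c : ℝ) (hc : 0 < c) (hΛc : ∀ᵐ x ∂(volume.restrict X), c ≤ Λ x)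
    (hstat : FieldTheory.IsStationary X p y ρ γ μ Λ) :
    -- the Euler-Lagrange system, as an identity of distributions on `X`
    (∀ φ : EuclideanSpace ℝ (Fin d) → ℝ, FieldTheory.IsTestFunction X φ →
      ∫ x in X, (ρ * p x * Λ x * (μ x - y x)) * φ x
        = -(2 * (1 - ρ) * γ * FieldTheory.weightedLaplacian X p μ φ)) ∧
    (∀ φ : EuclideanSpace ℝ (Fin d) → ℝ, FieldTheory.IsTestFunction X φ →
      ∫ x in X, (ρ / 2 * p x * ((μ x - y x) ^ 2 - 1 / Λ x)) * φ x
        = -(2 * (1 - ρ) * (1 - γ) * FieldTheory.weightedLaplacian X p Λ φ)) ∧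
    -- each penalized field has an integrable weighted Laplacian, satisfies its equation almost
    -- everywhere, and has zero flux through the boundary
    (ρ < 1 → 0 < γ →
      ∃ w : EuclideanSpace ℝ (Fin d) → ℝ, FieldTheory.HasWeightedLaplacian X p μ w ∧
        (∀ᵐ x ∂(volume.restrict X),
          ρ * p x * Λ x * (μ x - y x) = -(2 * (1 - ρ) * γ * w x)) ∧
        FieldTheory.ZeroFlux X p μ w) ∧
    (ρ < 1 → γ < 1 →
      ∃ w : EuclideanSpace ℝ (Fin d) → ℝ, FieldTheory.HasWeightedLaplacian X p Λ w ∧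
        (∀ᵐ x ∂(volume.restrict X),
          ρ / 2 * p x * ((μ x - y x) ^ 2 - 1 / Λ x) = -(2 * (1 - ρ) * (1 - γ) * w x)) ∧
        FieldTheory.ZeroFlux X p Λ w) := by
  have hXo := hX.isOpen
  have : IsFiniteMeasure (volume.restrict X) := ⟨by simpa using hX.isBounded.measure_lt_top⟩
  have hpm : AEStronglyMeasurable p (volume.restrict X) :=
    (hp.continuousOn.mono subset_closure).aestronglyMeasurable hXo.measurableSet
  obtain ⟨P, hP⟩ := hX.isBounded.isCompact_closure.exists_bound_of_continuousOn hp.continuousOn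
  have hpP : ∀ᵐ x ∂(volume.restrict X), ‖p x‖ ≤ P :=
    (ae_restrict_mem hXo.measurableSet).mono fun x hx => hP x (subset_closure hx)
  have hmean := fun g hg hgb =>
    hstat.mean_variation (φ := g) hXo hpm hpP hy hμ hΛ hc hΛc hg hgb
  have hprec := fun g hg hgb =>
    hstat.precision_variation (ψ := g) hXo hpm hpP hy hμ hΛ hc hΛc hg hgb
  refine ⟨fun φ hφ => ?_, fun φ hφ => ?_, fun hρ1 hγ0 => ?_, fun hρ1 hγ1 => ?_⟩
  · rw [hmean φ hφ.memH1 (hφ.memLp_restrict _),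
      FieldTheory.integral_weakGrad_inner_eq_weightedLaplacian hXo p μ hφ]
  · rw [hprec φ hφ.memH1 (hφ.memLp_restrict _),
      FieldTheory.integral_weakGrad_inner_eq_weightedLaplacian hXo p Λ hφ]
  · have hρ0 : 0 < 1 - ρ := sub_pos.2 hρ1
    -- Here `κ = 2 * (1 - ρ) * γ`, nonzero exactly because the mean is penalized.
    exact FieldTheory.exists_hasWeightedLaplacian_zeroFlux hXo (by positivity)
      (FieldTheory.integrable_mul_residual hpm hpP hy hμ hΛ hc hΛc hstat.finite) hmean
  · have hρ0 : 0 < 1 - ρ := sub_pos.2 hρ1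
    have hγ0 : 0 < 1 - γ := sub_pos.2 hγ1
    exact FieldTheory.exists_hasWeightedLaplacian_zeroFlux hXo (by positivity)
      (FieldTheory.integrable_mul_sq_residual_sub_inv hpm hpP hy hμ hΛ hc hΛc ρ) hprec
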